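/- Let $U,n_t\ge 1$ be integers. Let $K$ be an imaginary quadratic field of class number $1$, let $L\subset\mathbb{C}$ be a cyclic Galois extension of $K$ of degree $Un_t$ with $L=K(\alpha)$ for some $\alpha\in\mathbb{R}$, let $\sigma$ be a generator of $\mathrm{Gal}(L/K)$ and put $\tau=\sigma^U$. Let $p\in\mathcal{O}_K$ be a prime element that is inert in $L/K$ (it remains prime in $\mathcal{O}_L$), and let $m$ be an integer with $m>U(n_t-1)/2$. For $x=(x_1,\dots,x_{n_t})\in\mathcal{O}_L^{n_t}$ let $M(x)$ be the $n_t\times n_t$ matrix whose $(a,b)$ entry is $\tau^{b-1}(x_{a-b+1})$ if $b\le a$ and $p\,\tau^{b-1}(x_{n_t+a-b+1})$ if $b>a$. For $j=1,\dots,U$ the code of user $j$ is the lattice $\mathbf{L}_j\subset M_{n_t\times Un_t}(\mathbb{C})$ of all block matrices $$\left(M(x),\ \sigma(M(x)),\ \dots,\ p^{-m}\sigma^{j-1}(M(x)),\ \dots,\ \sigma^{U-1}(M(x))\right),\qquad x\in\mathcal{O}_L^{n_t},$$ in which only block $j$ carries the factor $p^{-m}$. Fix for each $j$ a lattice basis $B_{j,1},\dots,B_{j,r}$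 of $\mathbf{L}_j$ ($r=2Un_t^2$; linearly independent over $\mathbb{R}$, with $\mathbf{L}_j$ as its set of integral combinations), and for $N_j\ge 1$ let $\mathbf{L}_j(N_j)=\{\sum_i b_iB_{j,i} : b_i\in\mathbb{Z},\ -N_j\le b_i\le N_j\}$. The decay function of $C_{U,n_t}=(\mathbf{L}_1,\dots,\mathbf{L}_U)$ is $$D(N_1,\dots,N_U)=\min_{X_j\in\mathbf{L}_j(N_j)\setminus\{0\}}\sqrt{\det(MM^{\dagger})},$$ where $M$ is the $Un_t\times Un_t$ matrix obtained by stacking $X_1,\dots,X_U$ on top of each other. Then there are constants $c>0$ and $C>0$, independent of $N$, such that for all real $N\ge 1$ (in particular for all positive integers $N$) $$\frac{c}{N^{(U-1)n_t}}\le D(N,1,\dots,1)\le\frac{C}{N^{(U-1)n_t}}.$$ Moreover, the rate $\prod_{l=1}^{U-1}N_l^{-n_t^2(U-l)/(k-n_t(U-l))}$ of the generalized pigeon hole bound for $U$ users with code length $k=Un_t$ equals $1/N^{(U-1)n_t}$ when $N_1=N$ and $N_2=\dots=N_U=1$, so these codes meet that bound up to constants. -/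

import Mathlib

open scoped NumberField Matrix

noncomputable section

namespace MacCode

/-! ## Lattice codes, multiple access codes and their decay -/

/-- `B` is a lattice basis of `Λ`: the matrices `B i` are linearly independent over `ℝ` and
`Λ` is the set of their integral linear combinations. -/
def IsLatticeBasis {a c : Type*} {r : ℕ} (Λ : Set (Matrix a c ℂ)) (B : Fin r → Matrix a c ℂ) :
    Prop :=
  LinearIndependent ℝ B ∧ (Submodule.span ℤ (Set.range B) : Set (Matrix a c ℂ)) = Λ

/-- The finite code `L(N)` cut out of the lattice with basis `B`: all `∑ bᵢ Bᵢ` with integers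
`-N ≤ bᵢ ≤ N`. -/
def finiteCode {a c : Type*} {r : ℕ} (B : Fin r → Matrix a c ℂ) (N : ℝ) : Set (Matrix a c ℂ) :=
  {X | ∃ b : Fin r → ℤ, (∀ i, -N ≤ (b i : ℝ) ∧ (b i : ℝ) ≤ N) ∧ X = ∑ i, b i • B i}

/-- The matrix obtained by stacking the codewords of the users on top of each other. -/
def stack {ι a c : Type*} (X : ι → Matrix a c ℂ) : Matrix (ι × a) c ℂ :=
  Matrix.of fun q t => X q.1 q.2 t

/-- The values `√(det (M M†))`, where `M` is stacked from nonzero codewords of all users, user `j`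
using the finite code of size `N j`. -/
def decayValues {ι a c : Type*} [Fintype ι] [DecidableEq ι] [Fintype a] [DecidableEq a]
    [Fintype c] {r : ℕ} (B : ι → Fin r → Matrix a c ℂ) (N : ι → ℝ) : Set ℝ :=
  {d | ∃ X : ι → Matrix a c ℂ, (∀ j, X j ∈ finiteCode (B j) (N j) ∧ X j ≠ 0) ∧
    d = Real.sqrt ((stack X * (stack X)ᴴ).det).re}

/-- The decay function `D(N₁, …, N_U)`: the minimum of `√(det (M M†))`. It is a minimum by
`isLeast_decay` below. -/
def decay {ι a c : Type*} [Fintype ι] [DecidableEq ι] [Fintype a] [DecidableEq a]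
    [Fintype c] {r : ℕ} (B : ι → Fin r → Matrix a c ℂ) (N : ι → ℝ) : ℝ :=
  sInf (decayValues B N)

theorem finite_finiteCode {a c : Type*} {r : ℕ} (B : Fin r → Matrix a c ℂ) (N : ℝ) :
    (finiteCode B N).Finite := by
  refine Set.Finite.subset ((Set.finite_Icc (fun _ : Fin r => -⌊N⌋) (fun _ => ⌊N⌋)).image
    (fun b => ∑ i, b i • B i)) ?_
  rintro X ⟨b, hb, rfl⟩
  refine ⟨b, ⟨fun i => ?_, fun i => ?_⟩, rfl⟩
  · have h : -b i ≤ ⌊N⌋ := Int.le_floor.2 (by push_cast; linarith [(hb i).1])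
    show -⌊N⌋ ≤ b i
    linarith
  · exact Int.le_floor.2 (hb i).2

/-- When all the code sizes are at least `1`, the decay is attained. -/
theorem isLeast_decay {ι a c : Type*} [Fintype ι] [DecidableEq ι] [Fintype a] [DecidableEq a]
    [Fintype c] {r : ℕ} (hr : 0 < r) (B : ι → Fin r → Matrix a c ℂ)
    (hB : ∀ j, LinearIndependent ℝ (B j)) (N : ι → ℝ) (hN : ∀ j, 1 ≤ N j) :
    IsLeast (decayValues B N) (decay B N) := by
  have hfin : (decayValues B N).Finite := by
    refine Set.Finite.subset ((Set.Finite.pi' fun j => finite_finiteCode (B j) (N j)).image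
      (fun X => Real.sqrt ((stack X * (stack X)ᴴ).det).re)) ?_
    rintro d ⟨X, hX, rfl⟩
    exact ⟨X, fun j => (hX j).1, rfl⟩
  have hne : (decayValues B N).Nonempty := by
    refine ⟨_, fun j => B j ⟨0, hr⟩, fun j => ⟨⟨Pi.single ⟨0, hr⟩ 1, fun i => ?_, ?_⟩,
      (hB j).ne_zero _⟩, rfl⟩
    · have := hN j
      by_cases h : i = ⟨0, hr⟩
      · subst h; simp only [Pi.single_eq_same, Int.cast_one]; constructor <;> linarith
      · simp only [Pi.single_eq_of_ne h, Int.cast_zero]; constructor <;> linarith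
    · rw [Finset.sum_eq_single ⟨0, hr⟩]
      · simp
      · intro i _ h; simp [Pi.single_eq_of_ne h]
      · simp
  exact ⟨hne.csInf_mem hfin, fun d hd => csInf_le hfin.bddBelow hd⟩

/-- The rate `∏_{l=1}^{U-1} N_l ^ (-n²(U-l) / (k - n(U-l)))` of the generalized pigeon hole bound
for `U` users with `n` antennas each and code length `k`; here `N l` is the code size of
user `l`, users being numbered from `1`. -/
def pigeonHoleRate (U n k : ℕ) (N : ℕ → ℝ) : ℝ :=
  ∏ l ∈ Finset.Icc 1 (U - 1),
    N l ^ (-((n : ℝ) ^ 2 * ((U : ℝ) - l) / ((k : ℝ) - n * ((U : ℝ) - l))))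

/-! ## The construction -/

/-- The data `L/K`, `p`, `σ` are suitable for `U` users with `n` antennas: `K` is imaginary
quadratic of class number `1`; `L/K` is cyclic Galois of degree `U n` with generator `σ`;
`L = K(α)` with `α` real, where `L` is viewed inside `ℂ` by means of `φ`; and `p` is a prime of
`𝓞 K` that is inert (remains prime) in `L`. -/
structure IsSuitable (U n : ℕ) {K L : Type*} [Field K] [NumberField K] [Field L] [NumberField L]
    [Algebra K L] (φ : L →+* ℂ) (σ : L ≃ₐ[K] L) (p : 𝓞 K) : Prop where
  finrank_base : Module.finrank ℚ K = 2
  totallyComplex : NumberField.IsTotallyComplex K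
  classNumber_eq_one : NumberField.classNumber K = 1
  isGalois : IsGalois K L
  finrank_ext : Module.finrank K L = U * n
  generator : ∀ g : L ≃ₐ[K] L, g ∈ Subgroup.zpowers σ
  real_generator : ∃ α : L, (φ α).im = 0 ∧ IntermediateField.adjoin K {α} = ⊤
  prime : Prime p
  inert : Prime (algebraMap (𝓞 K) (𝓞 L) p)

/-- The left regular representation `M(x₁, …, xₙ)` of the cyclic algebra `(L/F, τ, p)`. With rows
and columns numbered from `0`, the entry at `(a, b)` is `τᵇ(x_{a-b})` on and below the diagonal
and `p τᵇ(x_{n+a-b})` above it (subtraction in `Fin n` is modulo `n`). -/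
def regRep {n : ℕ} {K L : Type*} [Field K] [Field L] [Algebra K L] (τ : L ≃ₐ[K] L) (p : K)
    (x : Fin n → L) : Matrix (Fin n) (Fin n) L :=
  Matrix.of fun a b =>
    if b ≤ a then (τ ^ (b : ℕ)) (x (a - b)) else algebraMap K L p * (τ ^ (b : ℕ)) (x (a - b))

/-- The codeword `(M, σ(M), …, p⁻ᵐ σʲ(M), …, σ^{U-1}(M))` of user `j` (users numbered from `0`),
with `M = M(x₁, …, xₙ)` and `τ = σ^U`. Column `(l, b)` is column `b` of block `l`. -/
def userCodeword {U n : ℕ} {K L : Type*} [Field K] [NumberField K] [Field L] [NumberField L]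
    [Algebra K L] (φ : L →+* ℂ) (σ : L ≃ₐ[K] L) (p : 𝓞 K) (m : ℤ) (j : Fin U)
    (x : Fin n → 𝓞 L) : Matrix (Fin n) (Fin U × Fin n) ℂ :=
  Matrix.of fun a q =>
    φ ((if q.1 = j then algebraMap K L (p : K) ^ (-m) else 1) *
      (σ ^ (q.1 : ℕ)) (regRep (σ ^ U) (p : K) (fun i => (x i : L)) a q.2))

/-- The lattice code of user `j`: all the codewords, including the zero matrix. -/
def userLattice {U : ℕ} (n : ℕ) {K L : Type*} [Field K] [NumberField K] [Field L] [NumberField L]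
    [Algebra K L] (φ : L →+* ℂ) (σ : L ≃ₐ[K] L) (p : 𝓞 K) (m : ℤ) (j : Fin U) :
    Set (Matrix (Fin n) (Fin U × Fin n) ℂ) :=
  Set.range (userCodeword (n := n) φ σ p m j)

end MacCode

end

open scoped NumberField Matrix

noncomputable section

namespace MacCode

/-! ## Twisted circulant matrices over a domain with an endomorphism -/

section Integral

variable {R : Type*} [CommRing R] {n : ℕ}

/-! The stacked matrix M is square, so √det(MM†) = |det M|. Multiplying M by p^m gives a matrix over
𝓞_L whose off-diagonal blocks are divisible by p^m; let e be its determinant.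

Lower bound. First, e ≠ 0 by a p-adic argument. Once powers of p are removed from each user's
vector, every diagonal block has a determinant of p-valuation at most n - 1 (`det_twist_eq`), and e
is congruent to the product of these determinants modulo p^(2m) (`sq_dvd_det_sub_prod_det`), where
2m > U(n - 1). Next, conjugation by the generator of the cyclic algebra gives σ^U e = e
(`pow_det_blockCode`), so e · σe ⋯ σ^(U-1)e is a nonzero element of 𝓞_K and has absolute value at
least 1 (`one_le_prod_norm_conj`). Each conjugate is O(N^n), because only the n rows of the first
user grow with N. Hence |e| is at least of order N^(-(U-1)n).

Upper bound. With fixed codewords for the other users, the determinant is, up to a constant, an n ×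
n determinant whose entries have 2n² real and imaginary parts, linear in the 2Un² integer
coordinates of the first user. Dirichlet's box principle makes all of them O(N^(-(U-1))) at once
(`exists_small_combination`, `exists_norm_det_stack_le`). -/

theorem pow_apply_eq_self {f : R →+* R} {p : R} (hp : f p = p) (k : ℕ) : (f ^ k) p = p := by
  induction k with
  | zero => rfl
  | succ k ih => rw [pow_succ, RingHom.mul_def, RingHom.comp_apply, hp, ih]

theorem dvd_of_dvd_pow_apply {f : R →+* R} {p : R} (hf : ∀ x, p ∣ f x → p ∣ x) (k : ℕ) :
    ∀ x, p ∣ (f ^ k) x → p ∣ x := by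
  induction k with
  | zero => exact fun x hx => hx
  | succ k ih =>
    intro x hx
    rw [pow_succ, RingHom.mul_def, RingHom.comp_apply] at hx
    exact hf _ (ih _ hx)

/-- The left regular representation of a cyclic algebra with integral coefficients. -/
def twist (f : R →+* R) (p : R) (x : Fin n → R) : Matrix (Fin n) (Fin n) R :=
  Matrix.of fun a b => (if b ≤ a then 1 else p) * (f ^ (b : ℕ)) (x (a - b))

/-- The image of the generator of the cyclic algebra under the left regular representation. -/
def shiftMatrix (n : ℕ) [NeZero n] (p : R) : Matrix (Fin n) (Fin n) R :=
  (Matrix.diagonal fun a : Fin n => if a = 0 then p else 1).submatrix id (Equiv.addRight 1)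

theorem shiftMatrix_mul_apply [NeZero n] (p : R) (M : Matrix (Fin n) (Fin n) R) (a b : Fin n) :
    (shiftMatrix n p * M) a b = (if a = 0 then p else 1) * M (a - 1) b := by
  rw [Matrix.mul_apply, Finset.sum_eq_single (a - 1)]
  · simp [shiftMatrix]
  · intro c _ hc
    have : a ≠ c + 1 := fun h => hc (by rw [h]; simp)
    simp [shiftMatrix, Matrix.diagonal_apply_ne _ this]
  · simp

theorem mul_shiftMatrix_apply [NeZero n] (p : R) (M : Matrix (Fin n) (Fin n) R) (a b : Fin n) :
    (M * shiftMatrix n p) a b = M a (b + 1) * (if b + 1 = 0 then p else 1) := by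
  rw [Matrix.mul_apply, Finset.sum_eq_single (b + 1)]
  · simp [shiftMatrix]
  · intro c _ hc
    simp [shiftMatrix, Matrix.diagonal_apply_ne _ hc]
  · simp

theorem det_shiftMatrix [NeZero n] (p : R) :
    ∃ u : ℤˣ, (shiftMatrix n p).det = (u : ℤ) * p := by
  refine ⟨Equiv.Perm.sign (Equiv.addRight (1 : Fin n)), ?_⟩
  rw [shiftMatrix, Matrix.det_permute', Matrix.det_diagonal]
  simp

theorem Fin.val_sub_one_add_one [NeZero n] (a : Fin n) (ha : a ≠ 0) :
    ((a - 1 : Fin n) : ℕ) + 1 = a := by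
  obtain ⟨k, rfl⟩ : ∃ k, n = k + 1 := ⟨n - 1, by have := NeZero.pos n; omega⟩
  rw [Fin.val_sub_one_of_ne_zero ha]
  have : (a : ℕ) ≠ 0 := fun h => ha (Fin.ext h)
  omega

theorem Fin.val_zero_sub_one [NeZero n] : (((0 : Fin n) - 1 : Fin n) : ℕ) + 1 = n := by
  obtain ⟨k, rfl⟩ : ∃ k, n = k + 1 := ⟨n - 1, by have := NeZero.pos n; omega⟩
  simp

/-- The weights of a twisted circulant matrix change under a shift of the rows by one. -/
theorem weight_shift_row [NeZero n] (p : R) (a b : Fin n) :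
    (if a = 0 then p else 1) * (if b ≤ a - 1 then 1 else p) =
      if a = b then p else if b ≤ a then 1 else p := by
  by_cases ha : a = 0
  · subst ha
    have h1 : b ≤ 0 - 1 := by
      rw [Fin.le_def]; have := Fin.val_zero_sub_one (n := n); omega
    rw [if_pos rfl, if_pos h1, mul_one]
    by_cases hb : b = 0
    · rw [if_pos hb.symm]
    · have h2 : ¬ b ≤ 0 := by simpa using hb
      rw [if_neg (Ne.symm hb), if_neg h2]
  · have h := Fin.val_sub_one_add_one a ha
    by_cases hab : a = b
    · subst hab
      have : ¬ a ≤ a - 1 := by rw [Fin.le_def]; omega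
      simp [ha, this]
    · have hne : (a : ℕ) ≠ b := fun h => hab (Fin.ext h)
      have : b ≤ a - 1 ↔ b ≤ a := by rw [Fin.le_def, Fin.le_def]; omega
      simp [ha, hab, this]

/-- Both sides equal p when a ≤ b and 1 otherwise. On the right, the last column b = n - 1 owes its
p to the second factor, since there b + 1 wraps to 0. -/
theorem weight_shift_both [NeZero n] (p : R) (a b : Fin n) :
    (if a = 0 then p else 1) * (if b ≤ a - 1 then 1 else p) =
      (if b + 1 ≤ a then 1 else p) * (if b + 1 = 0 then p else 1) := by
  rw [weight_shift_row]
  obtain ⟨c, rfl⟩ : ∃ c, b = c - 1 := ⟨b + 1, by simp⟩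
  by_cases hc : c = 0
  · subst hc
    have h := Fin.val_zero_sub_one (n := n)
    by_cases ha : a = 0 - 1
    · subst ha; simp
    · have hne : (a : ℕ) ≠ ((0 - 1 : Fin n) : ℕ) := fun h => ha (Fin.ext h)
      have : ¬ (0 - 1 ≤ a) := by rw [Fin.le_def]; have := a.2; omega
      simp only [if_neg ha, if_neg this]; simp
  · have h := Fin.val_sub_one_add_one c hc
    by_cases ha : a = c - 1
    · subst ha
      have : ¬ c ≤ c - 1 := by rw [Fin.le_def]; omega
      simp [hc, this]
    · have hne : (a : ℕ) ≠ ((c - 1 : Fin n) : ℕ) := fun h => ha (Fin.ext h)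
      have : c - 1 ≤ a ↔ c ≤ a := by rw [Fin.le_def, Fin.le_def]; omega
      simp [hc, ha, this]

/-- Extracting one factor of the generator on the left. -/
theorem twist_eq_shiftMatrix_mul [NeZero n] (f : R →+* R) {p : R} (hp : f p = p)
    (y z : Fin n → R) (h0 : y 0 = p * z (0 - 1)) (h : ∀ k, k ≠ 0 → y k = z (k - 1)) :
    twist f p y = shiftMatrix n p * twist f p z := by
  have hp' : ∀ k : ℕ, (f ^ k) p = p := pow_apply_eq_self hp
  ext a b
  rw [shiftMatrix_mul_apply]
  simp only [twist, Matrix.of_apply]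
  rw [← mul_assoc, weight_shift_row, sub_right_comm]
  by_cases hab : a = b
  · subst hab
    rw [if_pos rfl, if_pos le_rfl, sub_self, h0, one_mul, map_mul, hp']
  · rw [if_neg hab, h _ (sub_ne_zero.2 hab)]

/-- Conjugation by the generator acts on the left regular representation as the automorphism. -/
theorem twist_mul_shiftMatrix [NeZero n] (f : R →+* R) (p : R) (hp : f p = p) (hf : f ^ n = 1)
    (x : Fin n → R) :
    twist f p x * shiftMatrix n p = shiftMatrix n p * (twist f p x).map f := by
  -- In the last column the exponent falls back to 0 instead of rising to n; `f ^ n = 1` makes the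
  -- two agree.
  have key : ∀ b : Fin n, f ^ ((b + 1 : Fin n) : ℕ) = f * f ^ (b : ℕ) := fun b => by
    obtain ⟨c, rfl⟩ : ∃ c, b = c - 1 := ⟨b + 1, by simp⟩
    rw [sub_add_cancel, ← pow_succ']
    by_cases hc : c = 0
    · subst hc; rw [Fin.val_zero_sub_one, hf]; simp
    · rw [Fin.val_sub_one_add_one c hc]
  ext a b
  rw [shiftMatrix_mul_apply, mul_shiftMatrix_apply]
  simp only [twist, Matrix.of_apply, Matrix.map_apply, map_mul]
  rw [key, apply_ite f, hp, map_one, ← mul_assoc, weight_shift_both, RingHom.mul_def,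
    RingHom.comp_apply, show a - (b + 1) = a - 1 - b by abel]
  ring

/-- Modulo p the matrix is lower triangular with images of `y 0` under powers of f on the diagonal,
and the quotient by the prime p is a domain. -/
theorem not_dvd_det_twist [IsDomain R] (f : R →+* R) {p : R} (hp : Prime p)
    (hf : ∀ x, p ∣ f x → p ∣ x) [NeZero n] (y : Fin n → R) (h : ¬ p ∣ y 0) :
    ¬ p ∣ (twist f p y).det := by
  have hf' : ∀ (k : ℕ) x, p ∣ (f ^ k) x → p ∣ x := dvd_of_dvd_pow_apply hf
  have : (Ideal.span {p}).IsPrime := (Ideal.span_singleton_prime hp.ne_zero).2 hp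
  rw [← Ideal.mem_span_singleton, ← Ideal.Quotient.eq_zero_iff_mem, RingHom.map_det,
    Matrix.det_of_isLowerTriangular, Finset.prod_eq_zero_iff]
  · rintro ⟨a, -, ha⟩
    rw [RingHom.mapMatrix_apply, Matrix.map_apply, Ideal.Quotient.eq_zero_iff_mem,
      Ideal.mem_span_singleton, twist, Matrix.of_apply, if_pos le_rfl, one_mul, sub_self] at ha
    exact h (hf' _ _ ha)
  · intro a b hab
    have hab : ¬ b ≤ a := not_le.2 hab
    rw [RingHom.mapMatrix_apply, Matrix.map_apply, Ideal.Quotient.eq_zero_iff_mem,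
      Ideal.mem_span_singleton, twist, Matrix.of_apply, if_neg hab]
    exact dvd_mul_right _ _

/-- The `p`-adic valuation of the reduced norm of a primitive element is less than the degree. -/
theorem det_twist_eq [IsDomain R] (f : R →+* R) {p : R} (hp : Prime p) (hfp : f p = p)
    (hf : ∀ x, p ∣ f x → p ∣ x) [NeZero n] (i : ℕ) : ∀ (y : Fin n → R) (hi : i < n),
    ¬ p ∣ y ⟨i, hi⟩ → ∃ k u, k ≤ i ∧ ¬ p ∣ u ∧ (twist f p y).det = p ^ k * u := by
  induction i with
  | zero =>
    intro y hi hy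
    exact ⟨0, _, le_rfl, not_dvd_det_twist f hp hf y hy, by simp⟩
  | succ i ih =>
    intro y hi hy
    by_cases h0 : p ∣ y 0
    · obtain ⟨t, ht⟩ := h0
      -- Splitting off the generator moves every coordinate down by one and puts `y 0` divided by p
      -- in the last place. The coordinate not divisible by p thus gets closer to 0, at the cost of
      -- one factor ±p in the determinant.
      set z : Fin n → R := fun k => if k + 1 = 0 then t else y (k + 1) with hz
      have hz' : z ⟨i, by omega⟩ = y ⟨i + 1, hi⟩ := by
        have h1 : (⟨i + 1, hi⟩ : Fin n) ≠ 0 := by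
          intro h; simpa using congrArg Fin.val h
        have h2 := Fin.val_sub_one_add_one _ h1
        have h3 : (⟨i, by omega⟩ : Fin n) = ⟨i + 1, hi⟩ - 1 := Fin.ext (by simpa using h2.symm)
        simp only [hz]
        rw [h3, sub_add_cancel, if_neg h1]
      obtain ⟨k, u, hk, hu, hd⟩ := ih z (by omega) (hz' ▸ hy)
      obtain ⟨e, he⟩ := det_shiftMatrix (n := n) p
      refine ⟨k + 1, (e : ℤ) * u, by omega, fun h => hu ?_, ?_⟩
      · rcases Int.units_eq_one_or e with rfl | rfl <;> simpa using h
      · rw [twist_eq_shiftMatrix_mul f hfp y z (by simp [hz, ht]) (fun k hk => by simp [hz, hk]),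
          Matrix.det_mul, he, hd]
        ring
    · exact ⟨0, _, by omega, not_dvd_det_twist f hp hf y h0, by simp⟩

theorem twist_smul (f : R →+* R) (p c : R) (hc : f c = c) (x : Fin n → R) :
    twist f p (c • x) = c • twist f p x := by
  have hc' : ∀ k : ℕ, (f ^ k) c = c := pow_apply_eq_self hc
  ext a b
  simp only [twist, Matrix.of_apply, Pi.smul_apply, smul_eq_mul, map_mul, hc', Matrix.smul_apply]
  ring

/-- A nonzero vector is a power of `p` times a vector that is not divisible by `p`. -/
theorem exists_eq_pow_smul [IsDomain R] [WfDvdMonoid R] {p : R} (hp : Prime p) (x : Fin n → R)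
    (hx : x ≠ 0) : ∃ (k : ℕ) (y : Fin n → R), x = p ^ k • y ∧ ∃ i, ¬ p ∣ y i := by
  classical
  obtain ⟨i, hi⟩ := Function.ne_iff.1 hx
  have hfin := FiniteMultiplicity.of_prime_left hp hi
  obtain ⟨N, hN⟩ := hfin
  -- The least such k is the wanted exponent: by minimality p^k divides every coordinate, while
  -- p^(k+1) fails to divide one of them.
  have hex : ∃ k, ∃ i, ¬ p ^ (k + 1) ∣ x i := ⟨N, i, hN⟩
  obtain ⟨j, hj⟩ := Nat.find_spec hex
  have hall : ∀ i, p ^ Nat.find hex ∣ x i := by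
    intro i
    rcases Nat.eq_zero_or_eq_succ_pred (Nat.find hex) with h | h
    · rw [h]; simp
    · rw [h]
      by_contra hc
      exact Nat.find_min hex (m := (Nat.find hex).pred) (by omega) ⟨i, hc⟩
  choose y hy using hall
  refine ⟨_, y, funext hy, j, fun h => hj ?_⟩
  rw [hy j, pow_succ]
  exact mul_dvd_mul_left _ h

/-! ## Stacked codewords -/

variable {U : ℕ}

/-- The block matrix with blocks `f ^ l (twist (x j))`, multiplied by `q` off the diagonal. -/
def blockCode (f : R →+* R) (p q : R) (x : Fin U → Fin n → R) :
    Matrix (Fin U × Fin n) (Fin U × Fin n) R :=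
  Matrix.of fun i c =>
    (if c.1 = i.1 then 1 else q) * (f ^ (c.1 : ℕ)) (twist (f ^ U) p (x i.1) i.2 c.2)

/-- If the off-diagonal blocks are divisible by `q`, the determinant of a block matrix is congruent
modulo `q ^ 2` to the product of the determinants of its diagonal blocks. -/
theorem sq_dvd_det_sub_prod_det {κ ι : Type*} [Fintype κ] [DecidableEq κ] [Fintype ι]
    [DecidableEq ι] (q : R) (A : κ → κ → Matrix ι ι R) :
    q ^ 2 ∣ (Matrix.of fun i c : κ × ι =>
        (if c.1 = i.1 then 1 else q) * A i.1 c.1 i.2 c.2).det - ∏ j, (A j j).det := by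
  rw [← Matrix.det_blockDiagonal (fun j => A j j),
    ← Matrix.det_submatrix_equiv_self (Equiv.prodComm κ ι), Matrix.det_apply, Matrix.det_apply,
    ← Finset.sum_sub_distrib]
  refine Finset.dvd_sum fun π _ => ?_
  rw [← smul_sub, Units.smul_def, zsmul_eq_mul]
  refine Dvd.dvd.mul_left ?_ _
  by_cases hπ : ∀ i, (π i).1 = i.1
  · refine (dvd_zero _).trans (dvd_of_eq ?_)
    rw [eq_comm, sub_eq_zero]
    refine Finset.prod_congr rfl fun i _ => ?_
    simp [Matrix.blockDiagonal_apply, hπ]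
  · push Not at hπ
    obtain ⟨i, hi⟩ := hπ
    have h0 : ∏ i, (Matrix.blockDiagonal fun j => A j j).submatrix (Equiv.prodComm κ ι)
        (Equiv.prodComm κ ι) (π i) i = 0 := by
      refine Finset.prod_eq_zero (Finset.mem_univ i) ?_
      simp [Matrix.blockDiagonal_apply, hi]
    -- A permutation cannot change the block of just one index. Otherwise it would map the block
    -- receiving i into itself, hence onto itself by counting, leaving no room for the image of i.
    -- The two indices supply the two factors q.
    obtain ⟨i', hne, hi'⟩ : ∃ i', i' ≠ i ∧ (π i').1 ≠ i'.1 := by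
      by_contra! hc
      set S : Finset (κ × ι) := Finset.univ.filter fun c => c.1 = (π i).1 with hS
      have hsub : S.image π ⊆ S := by
        intro c hcS
        obtain ⟨d, hd, rfl⟩ := Finset.mem_image.1 hcS
        have hd' : d.1 = (π i).1 := by simpa [hS] using hd
        have hdi : d ≠ i := fun h => hi (by rw [← hd', h])
        simpa [hS, hc d hdi] using hd'
      have heq := Finset.eq_of_subset_of_card_le hsub
        (Finset.card_image_of_injective S π.injective).ge
      have hmem : π i ∈ S.image π := by rw [heq]; simp [hS]
      obtain ⟨d, hd, hdi⟩ := Finset.mem_image.1 hmem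
      rw [π.injective hdi] at hd
      exact hi (by simpa [hS, eq_comm] using hd)
    rw [h0, sub_zero, ← Finset.mul_prod_erase _ _ (Finset.mem_univ i),
      ← Finset.mul_prod_erase _ _ (Finset.mem_erase.2 ⟨hne, Finset.mem_univ i'⟩), sq,
      ← mul_assoc]
    refine Dvd.dvd.mul_right (mul_dvd_mul ?_ ?_) _
    · simp only [Matrix.of_apply, if_neg (Ne.symm hi)]
      exact dvd_mul_right _ _
    · simp only [Matrix.of_apply, if_neg (Ne.symm hi')]
      exact dvd_mul_right _ _

/-- The stacked codewords of nonzero users have nonzero determinant. -/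
theorem det_blockCode_ne_zero [IsDomain R] [WfDvdMonoid R] [NeZero n] (f : R →+* R) {p : R}
    (hp : Prime p) (hfp : f p = p) (hf : ∀ x, p ∣ f x → p ∣ x) (m : ℕ) (hm : U * (n - 1) < 2 * m)
    (x : Fin U → Fin n → R) (hx : ∀ j, x j ≠ 0) : (blockCode f p (p ^ m) x).det ≠ 0 := by
  have hfp' : ∀ k : ℕ, (f ^ k) p = p := pow_apply_eq_self hfp
  have hf' : ∀ (k : ℕ) x, p ∣ (f ^ k) x → p ∣ x := dvd_of_dvd_pow_apply hf
  choose k y hxy i hi using fun j => exists_eq_pow_smul hp (x j) (hx j)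
  have hdet : (blockCode f p (p ^ m) x).det =
      (∏ c : Fin U × Fin n, p ^ k c.1) * (blockCode f p (p ^ m) y).det := by
    rw [← Matrix.det_mul_column]
    congr 1
    ext a b
    simp only [blockCode, Matrix.of_apply]
    rw [hxy, twist_smul _ _ _ (by rw [map_pow, hfp']), Matrix.smul_apply, smul_eq_mul, map_mul,
      map_pow, hfp']
    ring
  rw [hdet]
  refine mul_ne_zero (Finset.prod_ne_zero_iff.2 fun _ _ => pow_ne_zero _ hp.ne_zero) fun h0 => ?_
  have h1 := sq_dvd_det_sub_prod_det (p ^ m)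
    (fun j l : Fin U => (f ^ (l : ℕ)).mapMatrix (twist (f ^ U) p (y j)))
  change (p ^ m) ^ 2 ∣ (blockCode f p (p ^ m) y).det - _ at h1
  choose e u he hu hdu using fun j =>
    det_twist_eq (f ^ U) hp (hfp' U) (hf' U) (i j) (y j) (i j).2 (hi j)
  rw [h0, zero_sub, dvd_neg] at h1
  simp_rw [← RingHom.map_det, hdu, map_mul, map_pow, hfp', Finset.prod_mul_distrib,
    Finset.prod_pow_eq_pow_sum, ← pow_mul] at h1
  -- The product of the diagonal determinants has valuation at most U(n - 1) < 2m, so p^(2m) cannot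
  -- divide it, as it would if the whole determinant vanished.
  have hlt : ∑ j, e j < m * 2 := by
    refine lt_of_le_of_lt (Finset.sum_le_card_nsmul _ _ (n - 1) fun j _ => ?_) ?_
    · have := he j; have := (i j).2; omega
    · simp; omega
  obtain ⟨d, hd⟩ := Nat.exists_eq_add_of_lt hlt
  rw [show m * 2 = ∑ j, e j + (d + 1) by omega, pow_add] at h1
  have h2 := (mul_dvd_mul_iff_left (pow_ne_zero _ hp.ne_zero)).1 h1
  have h3 := (dvd_pow_self p (Nat.succ_ne_zero d)).trans h2
  obtain ⟨j, -, hj⟩ := (hp.dvd_finsetProd_iff _).1 h3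
  exact hu j (hf' _ _ hj)

/-- The determinant of the stacked codewords is fixed by `f ^ U`. -/
theorem pow_det_blockCode [IsDomain R] [NeZero n] (f : R →+* R) {p q : R} (hp : p ≠ 0)
    (hfp : f p = p) (hfq : f q = q) (hf : f ^ (U * n) = 1) (x : Fin U → Fin n → R) :
    (f ^ U) (blockCode f p q x).det = (blockCode f p q x).det := by
  have hfp' : ∀ {p}, f p = p → ∀ k : ℕ, (f ^ k) p = p := fun hfp k => pow_apply_eq_self hfp k
  set P := shiftMatrix n p with hP
  have hPf : ∀ (k : ℕ) a b, (f ^ k) (P a b) = P a b := fun k a b => by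
    simp only [hP, shiftMatrix, Matrix.submatrix_apply, Matrix.diagonal_apply]
    split_ifs <;> simp only [hfp' hfp, map_one, map_zero]
  set S : Matrix (Fin U × Fin n) (Fin U × Fin n) R :=
    (Matrix.blockDiagonal fun _ : Fin U => P).submatrix (Equiv.prodComm _ _)
      (Equiv.prodComm _ _) with hS
  have hSdet : S.det ≠ 0 := by
    obtain ⟨e, he⟩ := det_shiftMatrix (n := n) p
    rw [hS, Matrix.det_submatrix_equiv_self, Matrix.det_blockDiagonal]
    refine Finset.prod_ne_zero_iff.2 fun _ _ => ?_
    rw [hP, he]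
    rcases Int.units_eq_one_or e with rfl | rfl <;> simpa using hp
  -- Each block satisfies the conjugation relation for the automorphism `f ^ U`; applying `f ^ l`
  -- keeps it because the shift matrix has entries fixed by f. Taking determinants then cancels
  -- `S.det`.
  have hcomm : blockCode f p q x * S = S * (f ^ U).mapMatrix (blockCode f p q x) := by
    ext ⟨j, a⟩ ⟨l, b⟩
    have h := congrArg (f ^ (l : ℕ)) (congrFun (congrFun
      (twist_mul_shiftMatrix (f ^ U) p (hfp' hfp U) (by rw [← pow_mul, hf]) (x j)) a) b)
    simp only [Matrix.mul_apply, map_sum, map_mul, ← hP, hPf, Matrix.map_apply] at h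
    simp only [Matrix.mul_apply, Fintype.sum_prod_type, hS, Matrix.submatrix_apply,
      Equiv.prodComm_apply, Prod.swap_prod_mk, Matrix.blockDiagonal_apply, mul_ite, mul_zero,
      ite_mul, zero_mul, RingHom.mapMatrix_apply, Matrix.map_apply]
    rw [Finset.sum_comm, Finset.sum_comm (f := fun i c => if j = i then _ else _)]
    simp only [Finset.sum_ite_eq, Finset.sum_ite_eq', Finset.mem_univ, if_true]
    simp only [blockCode, Matrix.of_apply, map_mul, apply_ite (f ^ U), map_one, hfp' hfq]
    simp only [mul_left_comm (P _ _), mul_assoc, ← Finset.mul_sum]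
    have h' := congrArg (fun z => (if l = j then 1 else q) * z) h
    simp only [Finset.mul_sum] at h' ⊢
    refine h'.trans (Finset.sum_congr rfl fun c _ => ?_)
    have hc := RingHom.congr_fun (Commute.pow_pow_self f l U).eq (twist (f ^ U) p (x j) c b)
    exact congrArg (fun z => (if l = j then 1 else q) * (P a c * z)) hc
  have h := congrArg Matrix.det hcomm
  rw [Matrix.det_mul, Matrix.det_mul, ← RingHom.map_det, mul_comm] at h
  exact (mul_left_cancel₀ hSdet h).symm

end Integral

/-! ## Determinant estimates -/

/-- The Leibniz expansion, with one bound per row. A bound uniform in the rows would lose the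
exponent n: only the n rows of the first user may contribute a factor N. -/
theorem norm_det_le_prod {ι : Type*} [Fintype ι] [DecidableEq ι] (M : Matrix ι ι ℂ) (r : ι → ℝ)
    (h : ∀ i j, ‖M i j‖ ≤ r i) : ‖M.det‖ ≤ (Fintype.card ι).factorial * ∏ i, r i := by
  rw [← Matrix.det_transpose, Matrix.det_apply]
  refine (norm_sum_le _ _).trans ((Finset.sum_le_card_nsmul _ _ (∏ i, r i) fun π _ => ?_).trans ?_)
  · rw [Units.smul_def, zsmul_eq_mul, norm_mul, norm_prod]
    have : ‖((Equiv.Perm.sign π : ℤ) : ℂ)‖ = 1 := by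
      rcases Int.units_eq_one_or (Equiv.Perm.sign π) with h | h <;> simp [h]
    rw [this, one_mul]
    exact Finset.prod_le_prod (fun _ _ => norm_nonneg _) fun i _ => h i _
  · rw [Finset.card_univ, Fintype.card_perm, nsmul_eq_mul]

theorem sqrt_re_det_mul_conjTranspose {ι : Type*} [Fintype ι] [DecidableEq ι]
    (M : Matrix ι ι ℂ) : Real.sqrt ((M * Mᴴ).det).re = ‖M.det‖ := by
  rw [Matrix.det_mul, Matrix.det_conjTranspose, Complex.star_def, Complex.mul_conj,
    Complex.ofReal_re, Complex.normSq_eq_norm_sq, Real.sqrt_sq (norm_nonneg _)]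

theorem prod_ite_fst_eq {U : ℕ} (n : ℕ) (hU : 0 < U) (C N : ℝ) :
    ∏ i : Fin U × Fin n, C * (if (i.1 : ℕ) = 0 then N else 1) = C ^ (U * n) * N ^ n := by
  have h : ∀ j : Fin U, (if (j : ℕ) = 0 then N else 1) = if j = ⟨0, hU⟩ then N else 1 :=
    fun j => by simp only [Fin.ext_iff]
  rw [Finset.prod_mul_distrib, Fintype.prod_prod_type, Fintype.prod_prod_type]
  simp only [h, Finset.prod_const, Finset.card_univ, Fintype.card_fin]
  rw [Finset.prod_pow, ← pow_mul, mul_comm n]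
  simp

/-! ## Simultaneous approximation -/

/-- Dirichlet's theorem: `U d` vectors in a real space of dimension `d` have a nonzero integral
combination with coefficients of absolute value at most `N` and of size `O(N ^ (1 - U))`. -/
theorem exists_small_combination {κ : Type*} [Fintype κ] {r U : ℕ} (hr : 0 < r)
    (hrU : r = U * Fintype.card κ) (A : Fin r → κ → ℝ) :
    ∃ C : ℝ, 0 < C ∧ ∀ N : ℝ, 1 ≤ N → ∃ t : Fin r → ℤ, t ≠ 0 ∧ (∀ i, |(t i : ℝ)| ≤ N) ∧
      ∀ k, |∑ i, t i * A i k| ≤ C / N ^ (U - 1) := by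
  classical
  have hU : 0 < U := Nat.pos_of_ne_zero fun h => by simp [h] at hrU; omega
  -- The added 1 makes the bound |v| < aQ strict, so that no value falls beyond the last of the
  -- half-open cells.
  set a : ℝ := 1 + ∑ k, ∑ i, |A i k| with ha
  have ha1 : ∀ k, ∑ i, |A i k| < a := fun k => by
    have := Finset.single_le_sum (f := fun k => ∑ i, |A i k|)
      (fun k _ => Finset.sum_nonneg fun i _ => abs_nonneg _) (Finset.mem_univ k)
    linarith
  have ha0 : 0 < a := by
    have : 0 ≤ ∑ k, ∑ i, |A i k| :=
      Finset.sum_nonneg fun k _ => Finset.sum_nonneg fun i _ => abs_nonneg _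
    linarith
  refine ⟨2 * a * 2 ^ (U - 1), by positivity, fun N hN => ?_⟩
  set Q : ℕ := ⌊N⌋₊ with hQ
  have hQN : (Q : ℝ) ≤ N := Nat.floor_le (by linarith)
  have hNQ : N < Q + 1 := Nat.lt_floor_add_one N
  have hQ1 : 1 ≤ Q := Nat.le_floor (by simpa using hN)
  have hQ1' : (1 : ℝ) ≤ Q := by exact_mod_cast hQ1
  set v : (Fin r → ℕ) → κ → ℝ := fun t k => ∑ i, t i * A i k with hv
  set S : Finset (Fin r → ℕ) := Fintype.piFinset fun _ => Finset.range (Q + 1) with hS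
  set T : Finset (κ → ℤ) := Fintype.piFinset fun _ => Finset.Ico 0 ((Q : ℤ) ^ U) with hT
  -- Each interval (-aQ, aQ) is cut into Q^U cells of length 2a / Q^(U-1), and F records the cell of
  -- every coordinate.
  set F : (Fin r → ℕ) → κ → ℤ :=
    fun t k => ⌊(v t k + a * Q) * (Q ^ U / (2 * a * Q))⌋ with hF
  -- There are (Q + 1)^r vectors but only Q^(U |κ|) = Q^r boxes.
  have hcard : T.card < S.card := by
    rw [hS, hT, Fintype.card_piFinset, Fintype.card_piFinset]
    simp only [Int.card_Ico, Finset.card_range, Finset.prod_const, Finset.card_univ,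
      Fintype.card_fin, sub_zero]
    have : ((Q : ℤ) ^ U).toNat = Q ^ U := by exact_mod_cast Int.toNat_natCast (Q ^ U)
    rw [this, ← pow_mul, ← hrU]
    exact Nat.pow_lt_pow_left (Nat.lt_succ_self Q) hr.ne'
  have hmaps : ∀ t ∈ S, F t ∈ T := by
    intro t ht
    rw [hT, Fintype.mem_piFinset]
    intro k
    have hvk : |v t k| < a * Q := by
      calc |v t k| ≤ ∑ i, |(t i : ℝ) * A i k| := Finset.abs_sum_le_sum_abs _ _
        _ ≤ ∑ i, Q * |A i k| := by
            refine Finset.sum_le_sum fun i _ => ?_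
            rw [abs_mul, Nat.abs_cast]
            have := Finset.mem_range.1 (Fintype.mem_piFinset.1 ht i)
            have : (t i : ℝ) ≤ Q := by exact_mod_cast Nat.lt_succ_iff.1 this
            gcongr
        _ = Q * ∑ i, |A i k| := by rw [Finset.mul_sum]
        _ < a * Q := by rw [mul_comm a]; have := ha1 k; gcongr
    rw [abs_lt] at hvk
    rw [Finset.mem_Ico, hF]
    constructor
    · refine Int.floor_nonneg.2 (mul_nonneg (by linarith) (by positivity))
    · rw [Int.floor_lt]
      push_cast
      calc (v t k + a * Q) * (Q ^ U / (2 * a * Q)) < (2 * a * Q) * (Q ^ U / (2 * a * Q)) := by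
            have : 0 < (Q : ℝ) ^ U / (2 * a * Q) := by positivity
            have := hvk.2
            gcongr
            linarith
        _ = Q ^ U := by field_simp
  obtain ⟨t, ht, t', ht', hne, heq⟩ := Finset.exists_ne_map_eq_of_card_lt_of_maps_to hcard hmaps
  refine ⟨fun i => (t i : ℤ) - t' i, fun h => hne (funext fun i => ?_), fun i => ?_, fun k => ?_⟩
  · have := congrFun h i
    simp only [Pi.zero_apply] at this
    omega
  · have h1 := Finset.mem_range.1 (Fintype.mem_piFinset.1 ht i)
    have h2 := Finset.mem_range.1 (Fintype.mem_piFinset.1 ht' i)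
    have h1' : (t i : ℝ) ≤ Q := by exact_mod_cast Nat.lt_succ_iff.1 h1
    have h2' : (t' i : ℝ) ≤ Q := by exact_mod_cast Nat.lt_succ_iff.1 h2
    have h3 : (0 : ℝ) ≤ t i := Nat.cast_nonneg _
    have h4 : (0 : ℝ) ≤ t' i := Nat.cast_nonneg _
    push_cast
    rw [abs_le]
    constructor <;> linarith
  · have hk := Int.abs_sub_lt_one_of_floor_eq_floor (congrFun heq k)
    rw [← sub_mul, add_sub_add_right_eq_sub, abs_mul,
      abs_of_pos (show 0 < (Q : ℝ) ^ U / (2 * a * Q) by positivity), ← lt_div_iff₀ (by positivity),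
      one_div_div] at hk
    have hsum : ∑ i, (((t i : ℤ) - t' i : ℤ) : ℝ) * A i k = v t k - v t' k := by
      rw [hv, ← Finset.sum_sub_distrib]
      refine Finset.sum_congr rfl fun i _ => ?_
      push_cast
      ring
    rw [hsum]
    refine hk.le.trans ?_
    obtain ⟨U', rfl⟩ : ∃ U', U = U' + 1 := ⟨U - 1, by omega⟩
    rw [Nat.add_sub_cancel, div_le_div_iff₀ (by positivity) (by positivity), pow_succ]
    -- Since Q ≥ 1, N < Q + 1 ≤ 2Q; this is the source of the factor 2^(U-1) in the constant.
    have : N ^ U' ≤ (2 * Q : ℝ) ^ U' := by gcongr; linarith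
    rw [mul_pow] at this
    calc 2 * a * Q * N ^ U' ≤ 2 * a * Q * (2 ^ U' * Q ^ U') := by gcongr
      _ = _ := by ring

/-- With the codewords of all users but the first fixed, the first user has codewords that bring
the determinant down to the order of the pigeon hole bound. -/
theorem exists_norm_det_stack_le {U n : ℕ} (hU : 0 < U) (hn : 0 < n)
    (B : Fin (2 * U * n ^ 2) → Matrix (Fin n) (Fin U × Fin n) ℂ)
    (Y : Fin U → Matrix (Fin n) (Fin U × Fin n) ℂ) (hY : (stack Y).det ≠ 0) :
    ∃ C : ℝ, 0 < C ∧ ∀ N : ℝ, 1 ≤ N → ∃ t : Fin (2 * U * n ^ 2) → ℤ, t ≠ 0 ∧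
      (∀ i, |(t i : ℝ)| ≤ N) ∧
      ‖(stack (Function.update Y ⟨0, hU⟩ (∑ i, t i • B i))).det‖ ≤ C / N ^ ((U - 1) * n) := by
  set j₀ : Fin U := ⟨0, hU⟩ with hj
  set W := (stack Y)⁻¹ with hW
  have hYW : stack Y * W = 1 := Matrix.mul_nonsing_inv _ (isUnit_iff_ne_zero.2 hY)
  -- The index set has 2n² elements: the real and imaginary parts of the n² entries of the first
  -- user's diagonal block after multiplication by W.
  obtain ⟨C, hC, h⟩ := exists_small_combination (κ := Fin n × Fin n × Bool) (U := U)
    (r := 2 * U * n ^ 2) (by positivity) (by simp; ring)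
    (fun t k => if k.2.2 then ((B t * W) k.1 (j₀, k.2.1)).re else ((B t * W) k.1 (j₀, k.2.1)).im)
  refine ⟨‖(stack Y).det‖ * (n.factorial * (2 * C) ^ n), by positivity, fun N hN => ?_⟩
  obtain ⟨t, ht0, htN, ht⟩ := h N hN
  refine ⟨t, ht0, htN, ?_⟩
  set X := ∑ i, t i • B i with hX
  set Z := stack (Function.update Y j₀ X) with hZ
  have hdet : Z.det = (Z * W).det * (stack Y).det := by
    rw [← Matrix.det_mul, Matrix.mul_assoc, hW, Matrix.nonsing_inv_mul _ (isUnit_iff_ne_zero.2 hY),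
      mul_one]
  have hrow : ∀ i c, i.1 ≠ j₀ → (Z * W) i c = (1 : Matrix _ _ ℂ) i c := fun i c hi => by
    rw [← hYW, Matrix.mul_apply, Matrix.mul_apply]
    simp [hZ, stack, Function.update_of_ne hi]
  have hrow0 : ∀ a c, (Z * W) (j₀, a) c = (X * W) a c := fun a c => by
    rw [Matrix.mul_apply, Matrix.mul_apply]
    simp [hZ, stack]
  -- The other users' rows of `Z * W` are rows of the identity, so only the first user's diagonal
  -- block contributes to the determinant.
  have hblock := Matrix.twoBlockTriangular_det (Z * W) (fun i => i.1 = j₀) fun i hi c hc => by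
    rw [hrow i c hi, Matrix.one_apply_ne]
    rintro rfl
    exact hi hc
  have hone : ((Z * W).toSquareBlockProp fun i => ¬ i.1 = j₀) = 1 := by
    ext i c
    change (Z * W) i c = _
    rw [hrow _ _ i.2, Matrix.one_apply, Matrix.one_apply]
    simp [Subtype.ext_iff]
  rw [hone, Matrix.det_one, mul_one] at hblock
  have hXW : ∀ a c, ‖(X * W) a (j₀, c)‖ ≤ 2 * C / N ^ (U - 1) := fun a c => by
    have hXe : (X * W) a (j₀, c) = ∑ i, (t i : ℂ) * (B i * W) a (j₀, c) := by
      rw [hX, Matrix.sum_mul, Matrix.sum_apply]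
      refine Finset.sum_congr rfl fun i _ => ?_
      rw [Matrix.smul_mul, Matrix.smul_apply, zsmul_eq_mul]
    have h1 := ht (a, c, true)
    have h2 := ht (a, c, false)
    simp only [if_true, Bool.false_eq_true, if_false] at h1 h2
    have hre : ((X * W) a (j₀, c)).re = ∑ i, (t i : ℝ) * ((B i * W) a (j₀, c)).re := by
      rw [hXe, Complex.re_sum]; simp
    have him : ((X * W) a (j₀, c)).im = ∑ i, (t i : ℝ) * ((B i * W) a (j₀, c)).im := by
      rw [hXe, Complex.im_sum]; simp
    refine (Complex.norm_le_abs_re_add_abs_im _).trans ?_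
    rw [hre, him, mul_div_assoc, two_mul (C / N ^ (U - 1))]
    exact add_le_add h1 h2
  have hcard : Fintype.card {i : Fin U × Fin n // i.1 = j₀} = n := by
    have e : Fin n ≃ {i : Fin U × Fin n // i.1 = j₀} :=
      { toFun := fun a => ⟨(j₀, a), rfl⟩
        invFun := fun i => i.1.2
        left_inv := fun _ => rfl
        right_inv := fun i => Subtype.ext (Prod.ext i.2.symm rfl) }
    rw [← Fintype.card_congr e, Fintype.card_fin]
  have hle := norm_det_le_prod ((Z * W).toSquareBlockProp fun i => i.1 = j₀)
    (fun _ => 2 * C / N ^ (U - 1)) (by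
      rintro ⟨⟨i, a⟩, hi⟩ ⟨⟨c, b⟩, hc⟩
      obtain rfl : i = j₀ := hi
      obtain rfl : c = j₀ := hc
      change ‖(Z * W) (j₀, a) (j₀, b)‖ ≤ _
      rw [hrow0]
      exact hXW a b)
  rw [Finset.prod_const, Finset.card_univ, hcard] at hle
  rw [hdet, hblock, norm_mul]
  calc _ ≤ (n.factorial * (2 * C / N ^ (U - 1)) ^ n) * ‖(stack Y).det‖ := by gcongr
    _ = _ := by rw [div_pow, ← pow_mul]; ring

/-! ## Algebraic integers -/

/-- The field has a single, complex, place, so |ψ k|² is the absolute value of the norm of k, a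
nonzero integer. -/
theorem one_le_norm_of_imaginaryQuadratic {K : Type*} [Field K] [NumberField K]
    [NumberField.IsTotallyComplex K] (hK : Module.finrank ℚ K = 2) (ψ : K →+* ℂ) (k : 𝓞 K)
    (hk : k ≠ 0) : 1 ≤ ‖ψ k‖ := by
  set w := NumberField.InfinitePlace.mk ψ with hw
  have hcard : Fintype.card (NumberField.InfinitePlace K) = 1 := by
    have h1 := NumberField.IsTotallyComplex.finrank K
    rw [NumberField.InfinitePlace.card_eq_nrRealPlaces_add_nrComplexPlaces,
      NumberField.IsTotallyComplex.nrRealPlaces_eq_zero K]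
    omega
  have := Fintype.card_le_one_iff_subsingleton.1 hcard.le
  have hprod := NumberField.InfinitePlace.prod_eq_abs_norm (k : K)
  rw [Fintype.prod_subsingleton _ w,
    NumberField.InfinitePlace.mult_isComplex ⟨w, NumberField.IsTotallyComplex.isComplex w⟩,
    hw, NumberField.InfinitePlace.apply] at hprod
  have hnorm : (1 : ℚ) ≤ |Algebra.norm ℚ (k : K)| := by
    rw [← Algebra.coe_norm_int]
    have : Algebra.norm ℤ k ≠ 0 := Algebra.norm_ne_zero_iff.2 hk
    exact_mod_cast Int.one_le_abs this
  have h1 : (1 : ℝ) ≤ ‖ψ k‖ ^ 2 := by rw [hprod]; exact_mod_cast hnorm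
  exact (one_le_sq_iff₀ (norm_nonneg _)).1 h1

/-! ## The codes -/

section Code

variable {K L : Type*} [Field K] [Field L] [Algebra K L]

/-- The action of an automorphism on the ring of integers. -/
def intAut (σ : L ≃ₐ[K] L) : 𝓞 L →+* 𝓞 L :=
  NumberField.RingOfIntegers.mapRingHom (σ : L →+* L)

theorem coe_intAut_pow (σ : L ≃ₐ[K] L) (k : ℕ) (x : 𝓞 L) :
    (((intAut σ ^ k) x : 𝓞 L) : L) = (σ ^ k) x := by
  induction k generalizing x with
  | zero => rfl
  | succ k ih =>
    rw [pow_succ, RingHom.mul_def, RingHom.comp_apply, ih, pow_succ, AlgEquiv.mul_apply]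
    rfl

theorem intAut_algebraMap (σ : L ≃ₐ[K] L) (p : 𝓞 K) :
    intAut σ (algebraMap (𝓞 K) (𝓞 L) p) = algebraMap (𝓞 K) (𝓞 L) p :=
  NumberField.RingOfIntegers.ext (σ.commutes (p : K))

theorem dvd_of_dvd_intAut (σ : L ≃ₐ[K] L) (p : 𝓞 K) (x : 𝓞 L)
    (h : algebraMap (𝓞 K) (𝓞 L) p ∣ intAut σ x) : algebraMap (𝓞 K) (𝓞 L) p ∣ x := by
  have h' := map_dvd (intAut σ⁻¹) h
  rw [intAut_algebraMap] at h'
  convert h'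
  exact NumberField.RingOfIntegers.ext (σ.symm_apply_apply (x : L)).symm

theorem intAut_pow_eq_one (σ : L ≃ₐ[K] L) {k : ℕ} (h : σ ^ k = 1) : intAut σ ^ k = 1 := by
  ext x
  rw [coe_intAut_pow, h]
  rfl

theorem pow_finrank_eq_one [FiniteDimensional K L] [IsGalois K L] (σ : L ≃ₐ[K] L) :
    σ ^ Module.finrank K L = 1 := by
  rw [← IsGalois.card_aut_eq_finrank K L]
  exact pow_card_eq_one'

variable [NumberField K] [NumberField L]

/-- The product of the conjugates of an algebraic integer lying in an intermediate field of an
imaginary quadratic base has absolute value at least `1`. -/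
theorem one_le_prod_norm_conj [NumberField.IsTotallyComplex K] [IsGalois K L]
    (hK : Module.finrank ℚ K = 2) (φ : L →+* ℂ) (σ : L ≃ₐ[K] L)
    (hσ : ∀ g : L ≃ₐ[K] L, g ∈ Subgroup.zpowers σ) {U : ℕ} (e : 𝓞 L) (he : e ≠ 0)
    (hU : (intAut σ ^ U) e = e) :
    1 ≤ ∏ i ∈ Finset.range U, ‖φ ((intAut σ ^ i) e : 𝓞 L)‖ := by
  have : FiniteDimensional K L := Module.Finite.of_restrictScalars_finite ℚ K L
  set P : 𝓞 L := ∏ i ∈ Finset.range U, (intAut σ ^ i) e with hP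
  have hinj : ∀ (i : ℕ) (x : 𝓞 L), x ≠ 0 → (intAut σ ^ i) x ≠ 0 := fun i x hx h => by
    have h' := congrArg (fun y : 𝓞 L => (y : L)) h
    simp only [coe_intAut_pow, map_zero, EmbeddingLike.map_eq_zero_iff] at h'
    exact hx (NumberField.RingOfIntegers.ext h')
  have hP0 : P ≠ 0 := Finset.prod_ne_zero_iff.2 fun i _ => hinj i e he
  have hfix : σ (P : L) = P := by
    have h1 : intAut σ P = P := by
      have hs : intAut σ P = ∏ i ∈ Finset.range U, (intAut σ ^ (i + 1)) e := by
        rw [hP, map_prod]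
        refine Finset.prod_congr rfl fun i _ => ?_
        rw [pow_succ', RingHom.mul_def, RingHom.comp_apply]
      -- Both ways of splitting the product over i ≤ U are compared: σ permutes the factors
      -- cyclically because σ^U fixes e, so it fixes P.
      have h2 := (Finset.prod_range_succ' (fun i => (intAut σ ^ i) e) U).symm.trans
        (Finset.prod_range_succ (fun i => (intAut σ ^ i) e) U)
      rw [hU, pow_zero] at h2
      rw [hs]
      exact mul_right_cancel₀ he h2
    exact congrArg (fun y : 𝓞 L => (y : L)) h1
  have hall : ∀ g : L ≃ₐ[K] L, g (P : L) = P := fun g => by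
    have hle : Subgroup.zpowers σ ≤ MulAction.stabilizer (L ≃ₐ[K] L) (P : L) := by
      rw [Subgroup.zpowers_le]
      exact hfix
    exact hle (hσ g)
  obtain ⟨k, hk⟩ := (IsGalois.mem_range_algebraMap_iff_fixed (P : L)).2 hall
  have hint : IsIntegral ℤ k := by
    have h : IsIntegral ℤ (P : L) := P.isIntegral_coe
    rw [← hk] at h
    exact (isIntegral_algebraMap_iff (algebraMap K L).injective).1 h
  have hk0 : (⟨k, hint⟩ : 𝓞 K) ≠ 0 := fun h => hP0 (by
    have h0 : k = 0 := congrArg (fun y : 𝓞 K => (y : K)) h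
    rw [h0, map_zero] at hk
    exact NumberField.RingOfIntegers.ext hk.symm)
  have h1 := one_le_norm_of_imaginaryQuadratic hK (φ.comp (algebraMap K L)) ⟨k, hint⟩ hk0
  have h2 : (φ.comp (algebraMap K L)) ((⟨k, hint⟩ : 𝓞 K) : K) =
      ∏ i ∈ Finset.range U, φ ((intAut σ ^ i) e : 𝓞 L) := by
    rw [← map_prod, ← map_prod]
    exact congrArg φ hk
  exact h1.trans_eq ((congrArg norm h2).trans (norm_prod _ _))

variable {U n : ℕ}

theorem userCodeword_apply (φ : L →+* ℂ) (σ : L ≃ₐ[K] L) (p : 𝓞 K) (m : ℤ) (j : Fin U)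
    (x : Fin n → 𝓞 L) (a : Fin n) (q : Fin U × Fin n) :
    userCodeword φ σ p m j x a q =
      (if q.1 = j then φ (algebraMap K L p) ^ (-m) else 1) *
        φ ((intAut σ ^ (q.1 : ℕ))
          (twist (intAut σ ^ U) (algebraMap (𝓞 K) (𝓞 L) p) x a q.2) : 𝓞 L) := by
  have hpow : ∀ b : ℕ, (intAut σ ^ U) ^ b = intAut σ ^ (U * b) := fun b => (pow_mul _ _ _).symm
  simp only [userCodeword, Matrix.of_apply, map_mul, coe_intAut_pow, twist, regRep, hpow]
  congr 1
  · split_ifs <;> simp [map_zpow₀]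
  · split_ifs
    · simp [pow_mul]
    · rw [map_mul, pow_mul, ← map_mul φ]; rfl

/-- Codewords depend additively on the coefficients. -/
def userCodewordHom (φ : L →+* ℂ) (σ : L ≃ₐ[K] L) (p : 𝓞 K) (m : ℤ) (j : Fin U) :
    (Fin n → 𝓞 L) →+ Matrix (Fin n) (Fin U × Fin n) ℂ :=
  AddMonoidHom.mk' (userCodeword φ σ p m j) fun x y => by
    ext a q
    simp only [userCodeword_apply, Matrix.add_apply, twist, Matrix.of_apply, Pi.add_apply, map_add,
      mul_add]

/-- Taking p^(-m) out of all blocks moves the weight from the diagonal blocks to the others, where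
it becomes p^m, and leaves a matrix over 𝓞_L. -/
theorem stack_userCodeword (φ : L →+* ℂ) (σ : L ≃ₐ[K] L) {p : 𝓞 K} (hp : p ≠ 0) (m : ℕ)
    (x : Fin U → Fin n → 𝓞 L) :
    stack (fun j => userCodeword φ σ p m j (x j)) =
      (φ (algebraMap K L p) ^ m)⁻¹ • (φ.comp (algebraMap (𝓞 L) L)).mapMatrix
        (blockCode (intAut σ) (algebraMap (𝓞 K) (𝓞 L) p)
          (algebraMap (𝓞 K) (𝓞 L) p ^ m) x) := by
  have hp0 : φ (algebraMap K L p) ≠ 0 := by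
    rw [Ne, map_eq_zero, map_eq_zero]
    exact fun h => hp (NumberField.RingOfIntegers.ext h)
  ext i c
  simp only [stack, Matrix.of_apply, userCodeword_apply, Matrix.smul_apply,
    RingHom.mapMatrix_apply, Matrix.map_apply, blockCode, map_mul, smul_eq_mul, zpow_neg,
    zpow_natCast, RingHom.comp_apply]
  rw [← mul_assoc]
  congr 1
  split_ifs with h
  · simp
  · rw [map_pow, map_pow]
    exact (inv_mul_cancel₀ (pow_ne_zero _ hp0)).symm

theorem norm_det_stack (φ : L →+* ℂ) (σ : L ≃ₐ[K] L) {p : 𝓞 K} (hp : p ≠ 0) (m : ℕ)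
    (x : Fin U → Fin n → 𝓞 L) :
    ‖(stack (fun j => userCodeword φ σ p m j (x j))).det‖ =
      (‖φ (algebraMap K L p) ^ m‖⁻¹) ^ (U * n) * ‖φ ((blockCode (intAut σ)
        (algebraMap (𝓞 K) (𝓞 L) p) (algebraMap (𝓞 K) (𝓞 L) p ^ m) x).det : 𝓞 L)‖ := by
  rw [stack_userCodeword φ σ hp, Matrix.det_smul, ← RingHom.map_det, norm_mul, norm_pow, norm_inv]
  simp

/-- The sum of the absolute values of the conjugates of an algebraic integer. -/
def conjSize (K : Type*) {L : Type*} [Field K] [NumberField K] [Field L] [NumberField L]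
    [Algebra K L] (φ : L →+* ℂ) (z : 𝓞 L) : ℝ :=
  haveI : FiniteDimensional K L := Module.Finite.of_restrictScalars_finite ℚ K L
  ∑ g : L ≃ₐ[K] L, ‖φ (g z)‖

theorem conjSize_nonneg (φ : L →+* ℂ) (z : 𝓞 L) : 0 ≤ conjSize K φ z :=
  Finset.sum_nonneg fun _ _ => norm_nonneg _

theorem norm_conj_le_conjSize (φ : L →+* ℂ) (σ : L ≃ₐ[K] L) (z : 𝓞 L) (i : ℕ) :
    ‖φ ((intAut σ ^ i) z : 𝓞 L)‖ ≤ conjSize K φ z := by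
  have : FiniteDimensional K L := Module.Finite.of_restrictScalars_finite ℚ K L
  rw [coe_intAut_pow]
  exact Finset.single_le_sum (f := fun g : L ≃ₐ[K] L => ‖φ (g z)‖) (fun _ _ => norm_nonneg _)
    (Finset.mem_univ (σ ^ i))

theorem norm_conj_sum_le (φ : L →+* ℂ) (σ : L ≃ₐ[K] L) {r : ℕ} (z : Fin r → 𝓞 L) (b : Fin r → ℤ)
    (w : ℝ) (hb : ∀ t, |(b t : ℝ)| ≤ w) (k : ℕ) :
    ‖φ ((intAut σ ^ k) (∑ t, b t • z t) : 𝓞 L)‖ ≤ (∑ t, conjSize K φ (z t)) * w := by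
  have he : φ ((intAut σ ^ k) (∑ t, b t • z t) : 𝓞 L) =
      ∑ t, (b t : ℂ) * φ ((intAut σ ^ k) (z t) : 𝓞 L) := by
    simp only [map_sum, zsmul_eq_mul, map_mul, map_intCast]
  rw [he, Finset.sum_mul]
  refine (norm_sum_le _ _).trans (Finset.sum_le_sum fun t _ => ?_)
  rw [norm_mul, Complex.norm_intCast, mul_comm]
  exact mul_le_mul (norm_conj_le_conjSize φ σ _ _) (hb t) (abs_nonneg _) (conjSize_nonneg _ _)

/-- An entry is a product of two weights and a conjugate of one coordinate. The factors 1 +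
`conjSize` cover both values of a weight, and the bound depends on the row only through its user. -/
theorem norm_conj_blockCode_le (φ : L →+* ℂ) (σ : L ≃ₐ[K] L) (p q : 𝓞 L)
    (x : Fin U → Fin n → 𝓞 L) (w : Fin U → ℝ)
    (hx : ∀ j a (k : ℕ), ‖φ ((intAut σ ^ k) (x j a) : 𝓞 L)‖ ≤ w j) (i : ℕ)
    (c d : Fin U × Fin n) :
    ‖φ ((intAut σ ^ i) (blockCode (intAut σ) p q x c d) : 𝓞 L)‖ ≤
      (1 + conjSize K φ q) * ((1 + conjSize K φ p) * w c.1) := by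
  have hmul : ∀ (k l : ℕ) (z : 𝓞 L), (intAut σ ^ k) ((intAut σ ^ l) z) = (intAut σ ^ (k + l)) z :=
    fun k l z => by rw [pow_add, RingHom.mul_def, RingHom.comp_apply]
  have hite : ∀ (P : Prop) [Decidable P] (z : 𝓞 L) (k : ℕ),
      ‖φ ((intAut σ ^ k) (if P then 1 else z) : 𝓞 L)‖ ≤ 1 + conjSize K φ z := by
    intro P _ z k
    split_ifs
    · simp only [map_one, norm_one]
      linarith [conjSize_nonneg (K := K) φ z]
    · linarith [norm_conj_le_conjSize φ σ z k]
  have he : (intAut σ ^ i) (blockCode (intAut σ) p q x c d) =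
      (intAut σ ^ i) (if d.1 = c.1 then 1 else q) *
        ((intAut σ ^ (i + d.1)) (if d.2 ≤ c.2 then 1 else p) *
          (intAut σ ^ (i + d.1 + U * d.2)) (x c.1 (c.2 - d.2))) := by
    rw [blockCode, Matrix.of_apply, map_mul, hmul, twist, Matrix.of_apply, map_mul, ← pow_mul, hmul]
  rw [he]
  simp only [map_mul, norm_mul]
  have h1 := conjSize_nonneg (K := K) φ p
  have h2 := conjSize_nonneg (K := K) φ q
  exact mul_le_mul (hite _ _ _) (mul_le_mul (hite _ _ _) (hx _ _ _) (norm_nonneg _) (by linarith))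
    (mul_nonneg (norm_nonneg _) (norm_nonneg _)) (by linarith)

/-- All the conjugates of the determinant are of order at most `N ^ n` when only the first user has
a large code. -/
theorem exists_norm_conj_det_le (hU : 0 < U) (φ : L →+* ℂ) (σ : L ≃ₐ[K] L) (p q : 𝓞 L) {r : ℕ}
    (hr : 0 < r) (ξ : Fin U → Fin r → Fin n → 𝓞 L) :
    ∃ C : ℝ, 0 < C ∧ ∀ (N : ℝ) (b : Fin U → Fin r → ℤ),
      (∀ j t, |(b j t : ℝ)| ≤ if (j : ℕ) = 0 then N else 1) → ∀ i : ℕ,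
      ‖φ ((intAut σ ^ i) (blockCode (intAut σ) p q fun j => ∑ t, b j t • ξ j t).det : 𝓞 L)‖ ≤
        C * N ^ n := by
  obtain ⟨G, hG0, hG⟩ : ∃ G : ℝ, 0 < G ∧ ∀ j a, ∑ t, conjSize K φ (ξ j t a) ≤ G := by
    have h0 : ∀ j a, 0 ≤ ∑ t, conjSize K φ (ξ j t a) := fun j a =>
      Finset.sum_nonneg fun _ _ => conjSize_nonneg _ _
    refine ⟨1 + ∑ j, ∑ a, ∑ t, conjSize K φ (ξ j t a), ?_, fun j a => ?_⟩
    · have := Finset.sum_nonneg fun j (_ : j ∈ Finset.univ) =>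
        Finset.sum_nonneg fun a (_ : a ∈ Finset.univ) => h0 j a
      linarith
    · have h1 := Finset.single_le_sum (fun a _ => h0 j a) (Finset.mem_univ a)
      have h2 := Finset.single_le_sum (fun j (_ : j ∈ Finset.univ) =>
        Finset.sum_nonneg fun a (_ : a ∈ Finset.univ) => h0 j a) (Finset.mem_univ j)
      linarith
  have h1 := conjSize_nonneg (K := K) φ p
  have h2 := conjSize_nonneg (K := K) φ q
  have hC : 0 < (1 + conjSize K φ q) * ((1 + conjSize K φ p) * G) := by positivity
  generalize hC₁ : (1 + conjSize K φ q) * ((1 + conjSize K φ p) * G) = C₁ at hC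
  refine ⟨((U * n).factorial : ℝ) * C₁ ^ (U * n), by positivity, fun N b hb i => ?_⟩
  have hx : ∀ j a (k : ℕ), ‖φ ((intAut σ ^ k) ((∑ t, b j t • ξ j t) a) : 𝓞 L)‖ ≤
      G * if (j : ℕ) = 0 then N else 1 := by
    intro j a k
    have h := norm_conj_sum_le φ σ (fun t => ξ j t a) (b j) _ (hb j) k
    rw [Finset.sum_apply]
    -- The bound on the coefficients is nonnegative because it dominates |b j 0|, and this
    -- coefficient exists as r > 0.
    exact h.trans (mul_le_mul_of_nonneg_right (hG j a) ((abs_nonneg _).trans (hb j ⟨0, hr⟩)))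
  have hbound := norm_det_le_prod ((φ.comp (algebraMap (𝓞 L) L)).mapMatrix
    ((intAut σ ^ i).mapMatrix (blockCode (intAut σ) p q fun j => ∑ t, b j t • ξ j t)))
    (fun c => C₁ * if (c.1 : ℕ) = 0 then N else 1) fun c d => by
      rw [← hC₁, mul_assoc, mul_assoc]
      exact norm_conj_blockCode_le φ σ p q _ _ hx i c d
  rw [prod_ite_fst_eq n hU, ← RingHom.map_det, ← RingHom.map_det, Fintype.card_prod,
    Fintype.card_fin, Fintype.card_fin, ← mul_assoc] at hbound
  exact hbound

end Code

/-- Only l = 1 contributes, with denominator Un - n(U - 1) = n and hence exponent -n(U - 1). For U =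
1 the product is empty. -/
theorem pigeonHoleRate_first_user {U n : ℕ} (hU : 0 < U) (hn : 0 < n) (N : ℝ) (hN : 1 ≤ N) :
    pigeonHoleRate U n (U * n) (fun l => if l = 1 then N else 1) = 1 / N ^ ((U - 1) * n) := by
  have hn' : (n : ℝ) ≠ 0 := by positivity
  unfold pigeonHoleRate
  rcases Nat.lt_or_ge 1 U with hU1 | hU1
  · rw [Finset.prod_eq_single 1]
    · have he : (-((n : ℝ) ^ 2 * ((U : ℝ) - (1 : ℕ)) /
          (((U * n : ℕ) : ℝ) - n * ((U : ℝ) - (1 : ℕ))))) = -(((U - 1) * n : ℕ) : ℝ) := by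
        have hd : (((U * n : ℕ) : ℝ) - n * ((U : ℝ) - (1 : ℕ))) = n := by push_cast; ring
        rw [hd, Nat.cast_mul, Nat.cast_sub hU]
        field_simp
      beta_reduce
      rw [if_pos rfl, he, Real.rpow_neg (by linarith), Real.rpow_natCast, one_div]
    · intro l _ hl
      beta_reduce
      rw [if_neg hl, Real.one_rpow]
    · intro h
      exact absurd (Finset.mem_Icc.2 ⟨le_rfl, by omega⟩) h
  · obtain rfl : U = 1 := by omega
    simp

/-! ### Nonvanishing and the lower bound for suitable data -/

section Bounds

variable {U n : ℕ} {K L : Type*} [Field K] [NumberField K] [Field L] [NumberField L] [Algebra K L]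
  {φ : L →+* ℂ} {σ : L ≃ₐ[K] L} {p : 𝓞 K}

theorem IsSuitable.det_blockCode_ne_zero (hs : IsSuitable U n φ σ p) (hn : 0 < n) {m : ℕ}
    (hm : U * (n - 1) < 2 * m) (x : Fin U → Fin n → 𝓞 L) (hx : ∀ j, x j ≠ 0) :
    (blockCode (intAut σ) (algebraMap (𝓞 K) (𝓞 L) p)
      (algebraMap (𝓞 K) (𝓞 L) p ^ m) x).det ≠ 0 := by
  have : NeZero n := ⟨hn.ne'⟩
  exact MacCode.det_blockCode_ne_zero (intAut σ) hs.inert (intAut_algebraMap σ p)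
    (dvd_of_dvd_intAut σ p) m hm x hx

theorem IsSuitable.one_le_prod_norm_conj_det (hs : IsSuitable U n φ σ p) (hn : 0 < n) {m : ℕ}
    (hm : U * (n - 1) < 2 * m) (x : Fin U → Fin n → 𝓞 L) (hx : ∀ j, x j ≠ 0) :
    1 ≤ ∏ i ∈ Finset.range U, ‖φ ((intAut σ ^ i) (blockCode (intAut σ)
      (algebraMap (𝓞 K) (𝓞 L) p) (algebraMap (𝓞 K) (𝓞 L) p ^ m) x).det : 𝓞 L)‖ := by
  have : NeZero n := ⟨hn.ne'⟩
  have := hs.totallyComplex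
  have := hs.isGalois
  have : FiniteDimensional K L := Module.Finite.of_restrictScalars_finite ℚ K L
  refine one_le_prod_norm_conj hs.finrank_base φ σ hs.generator _
    (hs.det_blockCode_ne_zero hn hm x hx) (pow_det_blockCode (intAut σ) hs.inert.ne_zero
      (intAut_algebraMap σ p) (by rw [map_pow, intAut_algebraMap]) (intAut_pow_eq_one σ ?_) x)
  rw [← hs.finrank_ext]
  exact pow_finrank_eq_one σ

variable {r : ℕ} {m : ℕ} {B : Fin U → Fin r → Matrix (Fin n) (Fin U × Fin n) ℂ}

/-- Lattice bases of the user codes come from vectors of algebraic integers. -/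
theorem exists_coefficients
    (hB : ∀ j, IsLatticeBasis (userLattice n φ σ p m j) (B j)) :
    ∃ ξ : Fin U → Fin r → Fin n → 𝓞 L, ∀ (j : Fin U) (b : Fin r → ℤ),
      ∑ t, b t • B j t = userCodeword φ σ p m j (∑ t, b t • ξ j t) := by
  have h : ∀ j t, ∃ ξ : Fin n → 𝓞 L, userCodeword φ σ p m j ξ = B j t := fun j t => by
    have h1 : B j t ∈ userLattice n φ σ p m j := by
      rw [← (hB j).2]
      exact Submodule.subset_span ⟨t, rfl⟩
    exact h1
  choose ξ hξ using h
  refine ⟨ξ, fun j b => ?_⟩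
  change _ = userCodewordHom φ σ p m j (∑ t, b t • ξ j t)
  rw [map_sum]
  refine Finset.sum_congr rfl fun t _ => ?_
  rw [map_zsmul, ← hξ]
  rfl

theorem userCodeword_zero (φ : L →+* ℂ) (σ : L ≃ₐ[K] L) (p : 𝓞 K) (m : ℤ) (j : Fin U) :
    userCodeword (n := n) φ σ p m j 0 = 0 :=
  map_zero (userCodewordHom φ σ p m j)

/-- The lower bound: the determinant of nonzero codewords is at least of order
`N ^ (-(U - 1) n)`. -/
theorem IsSuitable.exists_le_norm_det (hs : IsSuitable U n φ σ p) (hU : 0 < U) (hn : 0 < n)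
    (hr : 0 < r) (hm : U * (n - 1) < 2 * m)
    (hB : ∀ j, IsLatticeBasis (userLattice n φ σ p m j) (B j)) :
    ∃ c : ℝ, 0 < c ∧ ∀ N : ℝ, 1 ≤ N → ∀ X : Fin U → Matrix (Fin n) (Fin U × Fin n) ℂ,
      (∀ j, X j ∈ finiteCode (B j) (if (j : ℕ) = 0 then N else 1) ∧ X j ≠ 0) →
      c / N ^ ((U - 1) * n) ≤ ‖(stack X).det‖ := by
  have hp0 : φ (algebraMap K L p) ≠ 0 := by
    rw [Ne, map_eq_zero, map_eq_zero]
    exact fun h => hs.prime.ne_zero (NumberField.RingOfIntegers.ext h)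
  obtain ⟨ξ, hξ⟩ := exists_coefficients hB
  obtain ⟨C, hC, hle⟩ := exists_norm_conj_det_le hU φ σ (algebraMap (𝓞 K) (𝓞 L) p)
    (algebraMap (𝓞 K) (𝓞 L) p ^ m) hr ξ
  -- The numerator is the scalar p^(-m) taken out of all Un rows; C^(U-1) comes from the U - 1
  -- nontrivial conjugates.
  refine ⟨(‖φ (algebraMap K L p) ^ m‖⁻¹) ^ (U * n) / C ^ (U - 1), ?_,
    fun N hN X hX => ?_⟩
  · have := norm_pos_iff.2 (pow_ne_zero m hp0)
    exact div_pos (pow_pos (inv_pos.2 this) _) (pow_pos hC _)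
  choose b hb hXb using fun j => (hX j).1
  set x : Fin U → Fin n → 𝓞 L := fun j => ∑ t, b j t • ξ j t with hx
  have hXx : X = fun j => userCodeword φ σ p m j (x j) := funext fun j => by rw [hXb, hξ]
  have hx0 : ∀ j, x j ≠ 0 := fun j h => (hX j).2 (by rw [hXx]; simp only [h, userCodeword_zero])
  have hprod := hs.one_le_prod_norm_conj_det hn hm x hx0
  rw [hXx, norm_det_stack φ σ hs.prime.ne_zero]
  set e := (blockCode (intAut σ) (algebraMap (𝓞 K) (𝓞 L) p)
    (algebraMap (𝓞 K) (𝓞 L) p ^ m) x).det with he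
  have hconj : ∀ i : ℕ, ‖φ ((intAut σ ^ i) e : 𝓞 L)‖ ≤ C * N ^ n :=
    hle N b fun j t => abs_le.2 (hb j t)
  -- The factor i = 0 of the product is the determinant itself; the V = U - 1 others are bounded
  -- above.
  obtain ⟨V, rfl⟩ : ∃ V, U = V + 1 := ⟨U - 1, by omega⟩
  rw [Finset.prod_range_succ'] at hprod
  have h1 : ∏ i ∈ Finset.range V, ‖φ ((intAut σ ^ (i + 1)) e : 𝓞 L)‖ ≤ (C * N ^ n) ^ V := by
    refine (Finset.prod_le_prod (fun _ _ => norm_nonneg _) fun i _ => hconj (i + 1)).trans_eq ?_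
    rw [Finset.prod_const, Finset.card_range]
  have h2 : 1 ≤ (C * N ^ n) ^ V * ‖φ (e : L)‖ :=
    hprod.trans (mul_le_mul_of_nonneg_right h1 (norm_nonneg _))
  have hN0 : 0 < N := by linarith
  rw [Nat.add_sub_cancel, div_div, div_eq_mul_one_div]
  refine mul_le_mul_of_nonneg_left ?_ (by positivity)
  rw [div_le_iff₀ (by positivity)]
  calc 1 ≤ _ := h2
    _ = _ := by rw [mul_pow, ← pow_mul, mul_comm n V, mul_comm]

end Bounds

end MacCode

end

/-! ### The two bounds combined -/

theorem mainTheorem3 {U n : ℕ} (hU : 0 < U) (hn : 0 < n)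
    {K L : Type*} [Field K] [NumberField K] [Field L] [NumberField L] [Algebra K L]
    (φ : L →+* ℂ) (σ : L ≃ₐ[K] L) (p : 𝓞 K) (hs : MacCode.IsSuitable U n φ σ p)
    (m : ℤ) (hm : (U : ℝ) * ((n : ℝ) - 1) / 2 < (m : ℝ))
    (B : Fin U → Fin (2 * U * n ^ 2) → Matrix (Fin n) (Fin U × Fin n) ℂ)
    (hB : ∀ j, MacCode.IsLatticeBasis (MacCode.userLattice n φ σ p m j) (B j)) :
    (∃ c C : ℝ, 0 < c ∧ 0 < C ∧ ∀ N : ℝ, 1 ≤ N →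
      c / N ^ ((U - 1) * n) ≤ MacCode.decay B (fun j => if (j : ℕ) = 0 then N else 1) ∧
      MacCode.decay B (fun j => if (j : ℕ) = 0 then N else 1) ≤ C / N ^ ((U - 1) * n)) ∧
    ∀ N : ℝ, 1 ≤ N →
      MacCode.pigeonHoleRate U n (U * n) (fun l => if l = 1 then N else 1) =
        1 / N ^ ((U - 1) * n) := by
  refine ⟨?_, MacCode.pigeonHoleRate_first_user hU hn⟩
  have hr : 0 < 2 * U * n ^ 2 := by positivity
  have hn1 : ((n - 1 : ℕ) : ℝ) = n - 1 := by rw [Nat.cast_sub hn, Nat.cast_one]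
  obtain ⟨m, rfl⟩ : ∃ k : ℕ, m = k := Int.eq_ofNat_of_zero_le (by
    have h : (0 : ℝ) ≤ U * (n - 1) / 2 := by rw [← hn1]; positivity
    exact_mod_cast (h.trans hm.le))
  have hm' : U * (n - 1) < 2 * m := by
    rw [← hn1, div_lt_iff₀ (by norm_num)] at hm
    have : U * (n - 1) < m * 2 := by exact_mod_cast hm
    omega
  have hli : ∀ j, LinearIndependent ℝ (B j) := fun j => (hB j).1
  have hli' : ∀ j, LinearIndependent ℤ (B j) := fun j => (hli j).restrict_scalars' ℤ
  obtain ⟨c, hc, hlow⟩ := hs.exists_le_norm_det hU hn hr hm' hB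
  -- Reference codewords of size 1, independent of N; those of users other than the first stay in
  -- place for the upper bound.
  set Y : Fin U → Matrix (Fin n) (Fin U × Fin n) ℂ := fun j => B j ⟨0, hr⟩ with hYdef
  have hYmem : ∀ j, ∀ N : ℝ, 1 ≤ N → Y j ∈ MacCode.finiteCode (B j) N ∧ Y j ≠ 0 := by
    refine fun j N hN => ⟨⟨Pi.single ⟨0, hr⟩ 1, fun i => ?_, ?_⟩, (hli j).ne_zero _⟩
    · rcases eq_or_ne i ⟨0, hr⟩ with rfl | h
      · simp only [Pi.single_eq_same, Int.cast_one]; constructor <;> linarith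
      · simp only [Pi.single_eq_of_ne h, Int.cast_zero]; constructor <;> linarith
    · rw [Finset.sum_eq_single ⟨0, hr⟩]
      · simp [hYdef]
      · intro i _ h; simp [Pi.single_eq_of_ne h]
      · simp
  -- Nonvanishing is the lower bound at N = 1.
  have hY : (MacCode.stack Y).det ≠ 0 := by
    have h := hlow 1 le_rfl Y fun j => hYmem j _ (by simp)
    intro h0
    rw [h0, norm_zero, one_pow, div_one] at h
    linarith
  obtain ⟨C, hC, hup⟩ := MacCode.exists_norm_det_stack_le hU hn (B ⟨0, hU⟩) Y hY
  refine ⟨c, C, hc, hC, fun N hN => ?_⟩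
  have hleast := MacCode.isLeast_decay hr B hli (fun j => if (j : ℕ) = 0 then N else 1)
    (fun j => by split_ifs <;> simp [hN])
  constructor
  · obtain ⟨X, hX, hd⟩ := hleast.1
    rw [hd, MacCode.sqrt_re_det_mul_conjTranspose]
    exact hlow N hN X hX
  · obtain ⟨t, ht0, htN, ht⟩ := hup N hN
    refine (hleast.2 ⟨Function.update Y ⟨0, hU⟩ (∑ i, t i • B ⟨0, hU⟩ i), fun j => ?_,
      rfl⟩).trans ?_
    · rcases eq_or_ne j ⟨0, hU⟩ with rfl | hj
      · rw [Function.update_self]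
        refine ⟨⟨t, fun i => by simpa using abs_le.1 (htN i), rfl⟩, fun h => ht0 ?_⟩
        -- Independence of the basis turns the nonzero integer vector t into a nonzero codeword.
        exact funext (Fintype.linearIndependent_iff.1 (hli' _) t h)
      · rw [Function.update_of_ne hj]
        have : (j : ℕ) ≠ 0 := fun h => hj (Fin.ext h)
        simpa only [if_neg this] using hYmem j 1 le_rfl
    · rw [MacCode.sqrt_re_det_mul_conjTranspose]
      exact ht
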